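/- Let $F$ be Thompson's group: the group of all piecewise linear homeomorphisms of $[0,1]$ that are differentiable except at finitely many dyadic rationals and whose derivatives, on the intervals of differentiability, are powers of $2$, with product $(f\cdot g)(t)=g(f(t))$. An element $f\in F$ is represented by tree diagrams $(T_+,T_-)$, i.e. pairs of finite planar rooted binary trees with the same number of leaves: $f$ maps, for each $i$, the standard dyadic interval of the $i$-th leaf of $T_+$ affinely onto that of the $i$-th leaf of $T_-$. Draw the leaves on the $x$-axis, $T_+$ above it with its root joined by an edge to the line $y=1$, and $T_-$ upside down below it with its root joined to the line $y=-1$, so that the $i$-th leaves of the two trees coincide. The diagram cuts the strip $-1\le y\le 1$ into regions, and the strip is called $3$-colorable if the regions can be coloured with three colours so that any two regions sharing an edge have different colours; whether this holds does not depend on the choice of the tree diagram representing $f$. Let $\mathcal{F}\le F$ be the $3$-colorable subgroup, consisting of the elements whose strip is $3$-colorable. Then the quasi-regular representation of $F$ associated with $\mathcal{F}$, i.e. the unitary representation of $F$ on the complex Hilbert space $\ell^2(F/\mathcal{F})$ given by $(\pi(g)\xi)(x)=\xi(g^{-1}x)$, is irreducible: $\ell^2(F/\mathcal F)\neq 0$,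 and its only closed $F$-invariant subspaces are $0$ and $\ell^2(F/\mathcal{F})$. -/

import Mathlib

open scoped unitInterval ENNReal

noncomputable section

/-! ### Thompson's group `F` -/

/-- Dyadic rationals, the elements of `ℤ[1/2]`. -/
def IsDyadic (x : ℝ) : Prop := ∃ (a : ℤ) (n : ℕ), x = a / 2 ^ n

/-- `f` is piecewise linear with breakpoints in a finite set of dyadic rationals and slopes that
are powers of `2`: for some finite set `S` of dyadic rationals, `f` is affine with slope `2 ^ k`,
`k ∈ ℤ`, on every closed interval whose interior does not meet `S`. -/
def IsThompson (f : I ≃ₜ I) : Prop :=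
  ∃ S : Finset I, (∀ s ∈ S, IsDyadic (s : ℝ)) ∧
    ∀ a b : I, a < b → (∀ s ∈ S, s ∉ Set.Ioo a b) →
      ∃ k : ℤ, ∀ t ∈ Set.Icc a b, (f t : ℝ) = (f a : ℝ) + (2 : ℝ) ^ k * ((t : ℝ) - (a : ℝ))

theorem IsDyadic.add {x y : ℝ} (hx : IsDyadic x) (hy : IsDyadic y) : IsDyadic (x + y) := by
  obtain ⟨a, m, rfl⟩ := hx
  obtain ⟨b, n, rfl⟩ := hy
  refine ⟨a * 2 ^ n + b * 2 ^ m, m + n, ?_⟩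
  push_cast
  rw [pow_add]
  field_simp

theorem IsDyadic.neg {x : ℝ} (hx : IsDyadic x) : IsDyadic (-x) := by
  obtain ⟨a, m, rfl⟩ := hx
  exact ⟨-a, m, by push_cast; ring⟩

theorem IsDyadic.sub {x y : ℝ} (hx : IsDyadic x) (hy : IsDyadic y) : IsDyadic (x - y) := by
  rw [sub_eq_add_neg]; exact hx.add hy.neg

theorem IsDyadic.zpow_mul {x : ℝ} (hx : IsDyadic x) (k : ℤ) : IsDyadic ((2 : ℝ) ^ k * x) := by
  obtain ⟨a, m, rfl⟩ := hx
  obtain ⟨n, rfl | rfl⟩ := k.eq_nat_or_neg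
  · exact ⟨2 ^ n * a, m, by push_cast; rw [zpow_natCast]; ring⟩
  · refine ⟨a, m + n, ?_⟩
    rw [zpow_neg, zpow_natCast, pow_add]
    field_simp

theorem IsDyadic.zero : IsDyadic 0 := ⟨0, 0, by simp⟩

theorem IsThompson.strictMono {f : I ≃ₜ I} (hf : IsThompson f) : StrictMono f := by
  obtain ⟨S, -, hS⟩ := hf
  rcases f.continuous.strictMono_of_inj f.injective with h | h
  · exact h
  · exfalso
    set B : Finset I := insert 1 (S.filter (fun s => 0 < s)) with hB
    have hne : B.Nonempty := ⟨1, by simp [hB]⟩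
    have hb : (0 : I) < B.min' hne := by
      have := Finset.mem_insert.mp (B.min'_mem hne)
      rw [Finset.mem_filter] at this
      rcases this with h1 | h1
      · rw [h1]; exact zero_lt_one
      · exact h1.2
    obtain ⟨k, hk⟩ := hS 0 (B.min' hne) hb (fun s hs hs' => by
      have : B.min' hne ≤ s := B.min'_le s (by simp [hB, hs, hs'.1])
      exact absurd hs'.2 (not_lt.mpr this))
    have h1 := hk _ ⟨hb.le, le_rfl⟩
    have h2 : (f (B.min' hne) : ℝ) < f 0 := h hb
    have h3 : (0 : ℝ) < (2 : ℝ) ^ k := by positivity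
    have h4 : (0 : ℝ) < ((B.min' hne : I) : ℝ) - ((0 : I) : ℝ) := sub_pos.mpr hb
    nlinarith [mul_pos h3 h4]

theorem IsThompson.map_zero {f : I ≃ₜ I} (hf : IsThompson f) : f 0 = 0 := by
  apply le_antisymm _ unitInterval.nonneg'
  calc f 0 ≤ f (f.symm 0) := hf.strictMono.monotone unitInterval.nonneg'
    _ = 0 := by simp

/-- Any point `x > 0` has on its left a dyadic rational `m` such that `f` is affine on `[m, x]`. -/
theorem IsThompson.exists_left {f : I ≃ₜ I} {S : Finset I} (hd : ∀ s ∈ S, IsDyadic (s : ℝ))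
    (hS : ∀ a b : I, a < b → (∀ s ∈ S, s ∉ Set.Ioo a b) →
      ∃ k : ℤ, ∀ t ∈ Set.Icc a b, (f t : ℝ) = (f a : ℝ) + (2 : ℝ) ^ k * ((t : ℝ) - (a : ℝ)))
    (x : I) (hx : 0 < x) :
    ∃ m : I, m < x ∧ (m = 0 ∨ m ∈ S) ∧ IsDyadic (m : ℝ) ∧
      ∃ k : ℤ, (f x : ℝ) = (f m : ℝ) + (2 : ℝ) ^ k * ((x : ℝ) - (m : ℝ)) := by
  set B : Finset I := insert 0 (S.filter (fun s => s < x)) with hB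
  have hne : B.Nonempty := ⟨0, by simp [hB]⟩
  have hm := B.max'_mem hne
  have hmx : B.max' hne < x := by
    have := Finset.mem_insert.mp hm
    rw [Finset.mem_filter] at this
    rcases this with h1 | h1
    · rw [h1]; exact hx
    · exact h1.2
  have hmS : B.max' hne = 0 ∨ B.max' hne ∈ S := by
    have := Finset.mem_insert.mp hm
    rw [Finset.mem_filter] at this
    exact this.imp id And.left
  obtain ⟨k, hk⟩ := hS _ x hmx (fun s hs hs' => by
    have : s ≤ B.max' hne := B.le_max' s (by simp [hB, hs, hs'.2])
    exact absurd hs'.1 (not_lt.mpr this))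
  refine ⟨_, hmx, hmS, ?_, k, hk x ⟨hmx.le, le_rfl⟩⟩
  rcases hmS with h | h
  · rw [h]; exact IsDyadic.zero
  · exact hd _ h

theorem IsThompson.dyadic_map {f : I ≃ₜ I} (hf : IsThompson f) (x : I) (hx : IsDyadic (x : ℝ)) :
    IsDyadic (f x : ℝ) := by
  have hz := hf.map_zero
  obtain ⟨S, hd, hS⟩ := hf
  induction hn : (S.filter (fun s => s < x)).card using Nat.strong_induction_on generalizing x with
  | _ n ih =>
    rcases (unitInterval.nonneg' (t := x)).eq_or_lt with h0 | h0
    · rw [← h0, hz]; exact IsDyadic.zero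
    · obtain ⟨m, hmx, hm, hmd, k, hk⟩ := IsThompson.exists_left hd hS x h0
      rw [hk]
      refine IsDyadic.add ?_ ((hx.sub hmd).zpow_mul k)
      rcases hm with hm | hm
      · rw [hm, hz]; exact IsDyadic.zero
      · refine ih _ ?_ m hmd rfl
        rw [← hn]
        apply Finset.card_lt_card
        refine ⟨fun s hs => ?_, fun h => ?_⟩
        · simp only [Finset.mem_filter] at hs ⊢
          exact ⟨hs.1, hs.2.trans hmx⟩
        · have := h (Finset.mem_filter.mpr ⟨hm, hmx⟩)
          simp at this

theorem IsThompson.dyadic_symm {f : I ≃ₜ I} (hf : IsThompson f) (y : I) (hy : IsDyadic (y : ℝ)) :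
    IsDyadic (f.symm y : ℝ) := by
  have hmap := hf.dyadic_map
  obtain ⟨S, hd, hS⟩ := hf
  rcases (unitInterval.nonneg' (t := f.symm y)).eq_or_lt with h0 | h0
  · rw [← h0]; exact IsDyadic.zero
  · obtain ⟨m, -, -, hmd, k, hk⟩ := IsThompson.exists_left hd hS _ h0
    have : (f.symm y : ℝ) = (m : ℝ) + (2 : ℝ) ^ (-k) * ((y : ℝ) - (f m : ℝ)) := by
      rw [Homeomorph.apply_symm_apply] at hk
      rw [hk, zpow_neg]
      field_simp
      ring
    rw [this]
    exact hmd.add ((hy.sub (hmap m hmd)).zpow_mul _)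

theorem IsThompson.refl : IsThompson (Homeomorph.refl I) :=
  ⟨∅, by simp, fun a b _ _ => ⟨0, fun t _ => by simp⟩⟩

theorem IsThompson.trans {f g : I ≃ₜ I} (hf : IsThompson f) (hg : IsThompson g) :
    IsThompson (f.trans g) := by
  have hm := hf.strictMono
  have hsymm := hf.dyadic_symm
  obtain ⟨S, hdS, hS⟩ := hf
  obtain ⟨R, hdR, hR⟩ := hg
  classical
  refine ⟨S ∪ R.image f.symm, ?_, fun a b hab h => ?_⟩
  · intro s hs
    rcases Finset.mem_union.mp hs with hs | hs
    · exact hdS s hs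
    · obtain ⟨r, hr, rfl⟩ := Finset.mem_image.mp hs
      exact hsymm r (hdR r hr)
  · obtain ⟨k, hk⟩ := hS a b hab (fun s hs => h s (Finset.mem_union_left _ hs))
    obtain ⟨l, hl⟩ := hR (f a) (f b) (hm hab) (fun r hr hr' => by
      refine h (f.symm r)
        (Finset.mem_union_right _ (Finset.mem_image_of_mem _ hr)) ⟨?_, ?_⟩
      · rw [← hm.lt_iff_lt]; simpa using hr'.1
      · rw [← hm.lt_iff_lt]; simpa using hr'.2)
    refine ⟨l + k, fun t ht => ?_⟩
    have h1 := hl (f t) ⟨hm.monotone ht.1, hm.monotone ht.2⟩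
    have h2 := hk t ht
    rw [Homeomorph.trans_apply, Homeomorph.trans_apply, h1, h2, zpow_add₀ two_ne_zero]
    ring

theorem IsThompson.symm {f : I ≃ₜ I} (hf : IsThompson f) : IsThompson f.symm := by
  have hm := hf.strictMono
  have hmap := hf.dyadic_map
  obtain ⟨S, hdS, hS⟩ := hf
  classical
  refine ⟨S.image f, ?_, fun a b hab h => ?_⟩
  · intro s hs
    obtain ⟨r, hr, rfl⟩ := Finset.mem_image.mp hs
    exact hmap r (hdS r hr)
  · have hlt : ∀ x y : I, f.symm x < f.symm y ↔ x < y := fun x y => by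
      rw [← hm.lt_iff_lt]; simp
    have hle : ∀ x y : I, f.symm x ≤ f.symm y ↔ x ≤ y := fun x y => by
      rw [← hm.le_iff_le]; simp
    obtain ⟨k, hk⟩ := hS (f.symm a) (f.symm b) ((hlt a b).mpr hab) (fun r hr hr' => by
      refine h (f r) (Finset.mem_image_of_mem _ hr) ⟨?_, ?_⟩
      · rw [← hlt]; simpa using hr'.1
      · rw [← hlt]; simpa using hr'.2)
    refine ⟨-k, fun t ht => ?_⟩
    have h1 := hk (f.symm t) ⟨(hle a t).mpr ht.1, (hle t b).mpr ht.2⟩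
    rw [Homeomorph.apply_symm_apply, Homeomorph.apply_symm_apply] at h1
    rw [h1, zpow_neg]
    field_simp
    ring

/-- Thompson's group `F`: the piecewise linear homeomorphisms of `[0, 1]` with finitely many
breakpoints, all of them dyadic rationals, and with slopes that are powers of `2`. -/
def ThompsonF : Type := {f : I ≃ₜ I // IsThompson f}

/-- The group law of `F` is `(f * g) t = g (f t)`. -/
instance : Group ThompsonF where
  mul f g := ⟨f.1.trans g.1, f.2.trans g.2⟩
  one := ⟨Homeomorph.refl I, IsThompson.refl⟩
  inv f := ⟨f.1.symm, f.2.symm⟩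
  mul_assoc _ _ _ := rfl
  one_mul _ := rfl
  mul_one _ := rfl
  inv_mul_cancel f := Subtype.ext (Homeomorph.ext fun t => f.1.apply_symm_apply t)

theorem ThompsonF.mul_apply (f g : ThompsonF) (t : I) : (f * g).1 t = g.1 (f.1 t) := rfl

/-! ### Tree diagrams -/

/-- Finite planar rooted binary trees: `leaf` is the tree with one leaf and `node l r` is the tree
whose root has left subtree `l` and right subtree `r`. -/
inductive BinTree : Type where
  | leaf : BinTree
  | node : BinTree → BinTree → BinTree

namespace BinTree

def numLeaves : BinTree → ℕ
  | leaf => 1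
  | node l r => l.numLeaves + r.numLeaves

/-- The leaves from left to right, each given by the path from the root to it
(`false` is a left edge, `true` is a right edge). -/
def leaves : BinTree → List (List Bool)
  | leaf => [[]]
  | node l r => l.leaves.map (List.cons false) ++ r.leaves.map (List.cons true)

/-- Draw the tree so that its leaves are the points `a, a + 1, …, a + n - 1` of the `x`-axis.
The regions into which the tree cuts the half-strip are numbered by the gaps between these points:
region `i` meets the axis between `i - 1` and `i`; the region to the left of the tree is region
`a`, and the one to its right is region `a + n`. Every vertex `v` has an edge going upwards (for the
root it joins the root to the boundary line of the strip); if the leaves below `v` are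
`i, …, j - 1`, this edge separates region `i` from region `j`. The list of these pairs `(i, j)`
over all vertices `v` is `T.edges a`. -/
def edges : BinTree → ℕ → List (ℕ × ℕ)
  | leaf, a => [(a, a + 1)]
  | node l r, a => (a, a + (l.numLeaves + r.numLeaves)) ::
      (l.edges a ++ r.edges (a + l.numLeaves))

theorem length_leaves (T : BinTree) : T.leaves.length = T.numLeaves := by
  induction T with
  | leaf => rfl
  | node l r hl hr => simp [leaves, numLeaves, hl, hr]

theorem numLeaves_pos (T : BinTree) : 0 < T.numLeaves := by
  induction T with
  | leaf => exact Nat.one_pos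
  | node l r hl hr => simp only [numLeaves]; omega

end BinTree

/-- The point of `[0, 1]` whose binary expansion is that of `s` preceded by the word `w`;
`s ↦ wordPoint w s` is the increasing affine bijection from `[0, 1]` onto the standard dyadic
interval of the word `w`. -/
def wordPoint : List Bool → I → I
  | [], s => s
  | b :: w, s => ⟨((if b then 1 else 0) + (wordPoint w s : ℝ)) / 2, by
      have h0 := (wordPoint w s).2.1
      have h1 := (wordPoint w s).2.2
      constructor <;> split_ifs <;> linarith⟩

/-- A tree diagram: a top tree and a bottom tree with the same number of leaves. -/
structure TreeDiagram where
  top : BinTree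
  bottom : BinTree
  numLeaves_eq : top.numLeaves = bottom.numLeaves

namespace TreeDiagram

/-- The diagram represents `f` when `f` maps, for every `i`, the dyadic interval of the `i`-th leaf
of the top tree affinely onto the dyadic interval of the `i`-th leaf of the bottom tree. -/
def Represents (D : TreeDiagram) (f : I ≃ₜ I) : Prop :=
  List.Forall₂ (fun α β => ∀ s : I, f (wordPoint α s) = wordPoint β s) D.top.leaves D.bottom.leaves

/-- The graph whose vertices are the regions into which the diagram cuts the strip (the bottom tree
is reflected in the `x`-axis and its leaves are glued to those of the top tree, so that there is one
region for each of the `n + 1` gaps), two regions being adjacent when they share an edge of the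
diagram. -/
def stripGraph (D : TreeDiagram) : SimpleGraph (Fin (D.top.numLeaves + 1)) :=
  SimpleGraph.fromRel fun i j =>
    (i.1, j.1) ∈ D.top.edges 0 ∨ (i.1, j.1) ∈ D.bottom.edges 0

end TreeDiagram

/-! ### Colourings and parities of leaves -/

def wordSign (w : List Bool) : ZMod 3 := (-1) ^ w.length

/-- Successive differences of the colours of the regions `a, …, a + n`. -/
def colourDiffs (c : ℕ → ZMod 3) (a n : ℕ) : List (ZMod 3) :=
  (List.range n).map fun i => c (a + i + 1) - c (a + i)

theorem colourDiffs_add (c : ℕ → ZMod 3) (a m n : ℕ) :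
    colourDiffs c a (m + n) = colourDiffs c a m ++ colourDiffs c (a + m) n := by
  simp only [colourDiffs, List.range_add, List.map_append, List.map_map]
  congr 1
  apply List.map_congr_left
  intro i _
  simp [add_assoc]

theorem length_colourDiffs (c : ℕ → ZMod 3) (a n : ℕ) : (colourDiffs c a n).length = n := by
  simp [colourDiffs]

theorem wordSign_cons (b : Bool) (w : List Bool) : wordSign (b :: w) = - wordSign w := by
  simp [wordSign, pow_succ]

theorem wordSign_append (v w : List Bool) : wordSign (v ++ w) = wordSign v * wordSign w := by
  simp [wordSign, pow_add]

theorem wordSign_ne_zero (w : List Bool) : wordSign w ≠ 0 :=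
  pow_ne_zero _ (by decide)

theorem zmod3_third : ∀ x m y : ZMod 3, x ≠ y → x ≠ m → m ≠ y → m - x = -(y - x) ∧ y - m = -(y - x) := by
  decide

theorem BinTree.root_edge (T : BinTree) (a : ℕ) : (a, a + T.numLeaves) ∈ T.edges a := by
  cases T <;> simp [edges, numLeaves]

theorem BinTree.edges_bounds (T : BinTree) (a : ℕ) (p : ℕ × ℕ) (hp : p ∈ T.edges a) :
    p.1 < p.2 ∧ p.2 ≤ a + T.numLeaves := by
  induction T generalizing a with
  | leaf => simp only [edges, List.mem_singleton] at hp; subst hp; simp [numLeaves]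
  | node l r hl hr =>
    have h1 := l.numLeaves_pos
    simp only [edges, List.mem_cons, List.mem_append] at hp
    simp only [numLeaves]
    rcases hp with hp | hp | hp
    · subst hp; simp; omega
    · have := hl a hp; omega
    · have := hr _ hp; omega

theorem BinTree.diffs_of_proper (T : BinTree) (a : ℕ) (c : ℕ → ZMod 3)
    (h : ∀ p ∈ T.edges a, c p.1 ≠ c p.2) :
    T.leaves.map (fun w => wordSign w * (c (a + T.numLeaves) - c a)) =
      colourDiffs c a T.numLeaves := by
  induction T generalizing a with
  | leaf => simp [leaves, numLeaves, colourDiffs, wordSign]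
  | node l r hl hr =>
    have h0 := h _ (root_edge (node l r) a)
    simp only [edges, List.mem_cons, List.mem_append] at h
    have h1 := hl a (fun p hp => h p (Or.inr (Or.inl hp)))
    have h2 := hr (a + l.numLeaves) (fun p hp => h p (Or.inr (Or.inr hp)))
    have h3 := h _ (Or.inr (Or.inl (root_edge l a)))
    have h4 := h _ (Or.inr (Or.inr (root_edge r (a + l.numLeaves))))
    simp only [numLeaves] at h0 h3 h4 ⊢
    rw [← add_assoc] at h0 ⊢
    obtain ⟨h5, h6⟩ := zmod3_third _ _ _ h0 h3 h4
    rw [colourDiffs_add, ← h1, ← h2, h5, h6]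
    simp only [leaves, List.map_append, List.map_map, Function.comp_def, wordSign_cons]
    simp only [neg_mul, mul_neg]

theorem BinTree.proper_of_diffs (T : BinTree) (a : ℕ) (c : ℕ → ZMod 3) (δ : ZMod 3) (hδ : δ ≠ 0)
    (h : T.leaves.map (fun w => wordSign w * δ) = colourDiffs c a T.numLeaves) :
    (∀ p ∈ T.edges a, c p.1 ≠ c p.2) ∧ c (a + T.numLeaves) - c a = δ := by
  induction T generalizing a δ with
  | leaf =>
    have h' : c (a + 1) - c a = δ := by
      simpa [leaves, numLeaves, colourDiffs, wordSign] using h.symm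
    refine ⟨?_, by simpa [numLeaves] using h'⟩
    intro p hp
    simp only [edges, List.mem_singleton] at hp
    subst hp
    intro he
    apply hδ
    rw [← h', ← he, sub_self]
  | node l r hl hr =>
    simp only [leaves, numLeaves, colourDiffs_add, List.map_append, List.map_map,
      Function.comp_def, wordSign_cons, neg_mul_comm] at h
    obtain ⟨h1, h2⟩ := List.append_inj h (by
      rw [List.length_map, length_leaves, length_colourDiffs])
    obtain ⟨h3, h4⟩ := hl a (-δ) (neg_ne_zero.mpr hδ) h1
    obtain ⟨h5, h6⟩ := hr _ (-δ) (neg_ne_zero.mpr hδ) h2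
    have h7 : c (a + (l.numLeaves + r.numLeaves)) - c a = δ := by
      have : ∀ x m y δ : ZMod 3, m - x = -δ → y - m = -δ → y - x = δ := by decide
      rw [← add_assoc]
      exact this _ _ _ _ h4 h6
    refine ⟨fun p hp => ?_, h7⟩
    simp only [edges, List.mem_cons, List.mem_append] at hp
    rcases hp with hp | hp | hp
    · subst hp
      intro he
      apply hδ
      rw [← h7]
      simp only at he
      rw [← he, sub_self]
    · exact h3 p hp
    · exact h5 p hp

theorem colourDiffs_partialSums (L : List (ZMod 3)) :
    colourDiffs (fun i => (L.take i).sum) 0 L.length = L := by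
  apply List.ext_getElem
  · simp [colourDiffs]
  · intro i h1 h2
    simp [colourDiffs, List.sum_take_succ L i h2]

/-- The strip is 3-colourable exactly when corresponding leaves of the two trees have depths of the
same parity. -/
theorem TreeDiagram.colorable_iff (D : TreeDiagram) :
    D.stripGraph.Colorable 3 ↔
      D.top.leaves.map wordSign = D.bottom.leaves.map wordSign := by
  have hne := D.numLeaves_eq
  constructor
  · rintro ⟨C⟩
    let c : ℕ → ZMod 3 := fun i => if h : i < D.top.numLeaves + 1 then C ⟨i, h⟩ else 0
    have key : ∀ p : ℕ × ℕ, (p ∈ D.top.edges 0 ∨ p ∈ D.bottom.edges 0) → c p.1 ≠ c p.2 := by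
      intro p hp
      have hb : p.1 < p.2 ∧ p.2 ≤ D.top.numLeaves := by
        rcases hp with hp | hp
        · simpa using BinTree.edges_bounds _ _ _ hp
        · have := BinTree.edges_bounds _ _ _ hp; omega
      have h1 : p.1 < D.top.numLeaves + 1 := by omega
      have h2 : p.2 < D.top.numLeaves + 1 := by omega
      have hadj : D.stripGraph.Adj ⟨p.1, h1⟩ ⟨p.2, h2⟩ := by
        rw [stripGraph, SimpleGraph.fromRel_adj]
        exact ⟨fun h => by simp at h; omega, Or.inl hp⟩
      have := C.valid hadj
      have e1 : c p.1 = C ⟨p.1, h1⟩ := dif_pos h1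
      have e2 : c p.2 = C ⟨p.2, h2⟩ := dif_pos h2
      rw [e1, e2]
      exact this
    have h1 := D.top.diffs_of_proper 0 c (fun p hp => key p (Or.inl hp))
    have h2 := D.bottom.diffs_of_proper 0 c (fun p hp => key p (Or.inr hp))
    have h3 := key _ (Or.inl (D.top.root_edge 0))
    rw [← hne, ← h1] at h2
    have hδ : c (0 + D.top.numLeaves) - c 0 ≠ 0 := sub_ne_zero.mpr h3.symm
    have h4 := congrArg (List.map fun x => x * (c (0 + D.top.numLeaves) - c 0)⁻¹) h2
    have : Fact (Nat.Prime 3) := ⟨by norm_num⟩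
    simp only [List.map_map, Function.comp_def, mul_assoc, mul_inv_cancel₀ hδ, mul_one] at h4
    exact h4.symm
  · intro h
    let L := D.top.leaves.map wordSign
    have hL : L.length = D.top.numLeaves := by simp [L, BinTree.length_leaves]
    let c : ℕ → ZMod 3 := fun i => (L.take i).sum
    have hc : colourDiffs c 0 D.top.numLeaves = L := by
      rw [← hL]; exact colourDiffs_partialSums L
    have h1 := (D.top.proper_of_diffs 0 c 1 (by decide) (by rw [hc]; simp [L])).1
    have h2 := (D.bottom.proper_of_diffs 0 c 1 (by decide) (by rw [← hne, hc]; simp [L, h])).1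
    refine ⟨SimpleGraph.Coloring.mk (fun i => (c i.1 : Fin 3)) ?_⟩
    intro i j hij
    rw [stripGraph, SimpleGraph.fromRel_adj] at hij
    rcases hij.2 with (hp | hp) | (hp | hp)
    · exact h1 _ hp
    · exact h2 _ hp
    · exact (h1 _ hp).symm
    · exact (h2 _ hp).symm

/-! ### Refining tree diagrams -/

namespace BinTree

/-- Attach the trees of the list to the leaves, from left to right. -/
def graft : BinTree → List BinTree → BinTree
  | leaf, ts => ts.headD leaf
  | node l r, ts => node (l.graft (ts.take l.numLeaves)) (r.graft (ts.drop l.numLeaves))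

def expand : List (List Bool) → List BinTree → List (List Bool)
  | α :: L, t :: ts => t.leaves.map (fun w => α ++ w) ++ expand L ts
  | _, _ => []

theorem expand_append (L M : List (List Bool)) (ts : List BinTree) (h : L.length ≤ ts.length) :
    expand (L ++ M) ts = expand L (ts.take L.length) ++ expand M (ts.drop L.length) := by
  induction L generalizing ts with
  | nil => simp [expand]
  | cons α L ih =>
    cases ts with
    | nil => simp at h
    | cons t ts => simp [expand, ih ts (by simpa using h)]

theorem expand_map_cons (b : Bool) (L : List (List Bool)) (ts : List BinTree) :
    expand (L.map (List.cons b)) ts = (expand L ts).map (List.cons b) := by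
  induction L generalizing ts with
  | nil => simp [expand]
  | cons α L ih => cases ts <;> simp [expand, ih, Function.comp_def]

theorem leaves_graft (T : BinTree) (ts : List BinTree) (h : ts.length = T.numLeaves) :
    (T.graft ts).leaves = expand T.leaves ts := by
  induction T generalizing ts with
  | leaf =>
    obtain ⟨t, rfl⟩ := List.length_eq_one_iff.mp h
    simp [graft, leaves, expand]
  | node l r hl hr =>
    simp only [numLeaves] at h
    have h1 := hl (ts.take l.numLeaves) (by simp; omega)
    have h2 := hr (ts.drop l.numLeaves) (by simp; omega)
    rw [leaves, expand_append _ _ _ (by simp [length_leaves]; omega)]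
    simp only [graft, leaves, h1, h2, expand_map_cons, List.length_map, length_leaves]

theorem graft_replicate_leaf (T : BinTree) : T.graft (List.replicate T.numLeaves leaf) = T := by
  induction T with
  | leaf => rfl
  | node l r hl hr => simp [graft, numLeaves, hl, hr]

/-- Any two trees have a common refinement. -/
theorem exists_common_graft (T U : BinTree) : ∃ ts us : List BinTree,
    ts.length = T.numLeaves ∧ us.length = U.numLeaves ∧ T.graft ts = U.graft us := by
  induction T generalizing U with
  | leaf => exact ⟨[U], List.replicate U.numLeaves leaf, rfl, by simp,
      by rw [graft_replicate_leaf]; rfl⟩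
  | node l r hl hr =>
    cases U with
    | leaf => exact ⟨List.replicate (node l r).numLeaves leaf, [node l r], by simp, rfl,
        by rw [graft_replicate_leaf]; rfl⟩
    | node l' r' =>
      obtain ⟨ts, us, h1, h2, h3⟩ := hl l'
      obtain ⟨ts', us', h1', h2', h3'⟩ := hr r'
      refine ⟨ts ++ ts', us ++ us', by simp [numLeaves, h1, h1'], by simp [numLeaves, h2, h2'], ?_⟩
      simp only [graft, ← h1, ← h2, List.take_left, List.drop_left, h3, h3']

theorem forall₂_expand {R : List Bool → List Bool → Prop}
    (hR : ∀ α β w, R α β → R (α ++ w) (β ++ w)) {L M : List (List Bool)}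
    (h : List.Forall₂ R L M) (ts : List BinTree) : List.Forall₂ R (expand L ts) (expand M ts) := by
  induction h generalizing ts with
  | nil => simp [expand]
  | cons hab _ ih =>
    cases ts with
    | nil => simp [expand]
    | cons t ts =>
      simp only [expand]
      refine List.rel_append ?_ (ih ts)
      rw [List.forall₂_map_left_iff, List.forall₂_map_right_iff]
      exact List.forall₂_same.mpr fun w _ => hR _ _ w hab

theorem forall₂_trans {R S T : List Bool → List Bool → Prop}
    (hRST : ∀ α β γ, R α β → S β γ → T α γ) {L M N : List (List Bool)}
    (h : List.Forall₂ R L M) (h' : List.Forall₂ S M N) : List.Forall₂ T L N := by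
  induction h generalizing N with
  | nil => cases h'; exact List.Forall₂.nil
  | cons hab _ ih =>
    cases h' with
    | cons hbc h'' => exact List.Forall₂.cons (hRST _ _ _ hab hbc) (ih h'')

end BinTree

theorem wordPoint_append (v w : List Bool) (s : I) :
    wordPoint (v ++ w) s = wordPoint v (wordPoint w s) := by
  induction v with
  | nil => rfl
  | cons b v ih => simp [wordPoint, ih]

/-- `f` maps the interval of `α` affinely to that of `β`, and the two words have lengths of the
same parity. -/
def EvenMove (f : I ≃ₜ I) (α β : List Bool) : Prop :=
  (∀ s : I, f (wordPoint α s) = wordPoint β s) ∧ wordSign α = wordSign β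

theorem EvenMove.append {f : I ≃ₜ I} (α β w : List Bool) (h : EvenMove f α β) :
    EvenMove f (α ++ w) (β ++ w) :=
  ⟨fun s => by rw [wordPoint_append, wordPoint_append, h.1],
    by rw [wordSign_append, wordSign_append, h.2]⟩

theorem exists_colorable_iff (f : I ≃ₜ I) :
    (∃ D : TreeDiagram, D.Represents f ∧ D.stripGraph.Colorable 3) ↔
      ∃ T U : BinTree, List.Forall₂ (EvenMove f) T.leaves U.leaves := by
  constructor
  · rintro ⟨D, hD, hc⟩
    refine ⟨D.top, D.bottom, ?_⟩
    rw [D.colorable_iff] at hc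
    have h2 : List.Forall₂ (fun α β => wordSign α = wordSign β) D.top.leaves D.bottom.leaves := by
      rw [← List.forall₂_eq_eq_eq, List.forall₂_map_left_iff, List.forall₂_map_right_iff] at hc
      exact hc
    rw [TreeDiagram.Represents, List.forall₂_iff_get] at hD
    rw [List.forall₂_iff_get] at h2 ⊢
    exact ⟨hD.1, fun i h h' => ⟨hD.2 i h h', h2.2 i h h'⟩⟩
  · rintro ⟨T, U, h⟩
    refine ⟨⟨T, U, by rw [← T.length_leaves, ← U.length_leaves]; exact h.length_eq⟩,
      h.imp fun _ _ h => h.1, ?_⟩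
    rw [TreeDiagram.colorable_iff]
    rw [← List.forall₂_eq_eq_eq, List.forall₂_map_left_iff, List.forall₂_map_right_iff]
    exact h.imp fun _ _ h => h.2

/-! ### The 3-colorable subgroup -/

/-- The 3-colorable subgroup of `F`: the elements represented by a tree diagram whose strip is
3-colorable. The choice of the diagram does not matter, see `mem_threeColorableSubgroup_iff`. -/
def threeColorableSubgroup : Subgroup ThompsonF where
  carrier := {f | ∃ D : TreeDiagram, D.Represents f.1 ∧ D.stripGraph.Colorable 3}
  one_mem' := by
    rw [Set.mem_ofPred_eq, exists_colorable_iff]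
    exact ⟨BinTree.leaf, BinTree.leaf, List.forall₂_same.mpr fun w _ => ⟨fun s => rfl, rfl⟩⟩
  mul_mem' := by
    intro f g hf hg
    rw [Set.mem_ofPred_eq, exists_colorable_iff] at hf hg ⊢
    obtain ⟨T, U, h⟩ := hf
    obtain ⟨V, W, h'⟩ := hg
    obtain ⟨ts, us, h1, h2, h3⟩ := U.exists_common_graft V
    have hT : ts.length = T.numLeaves := by
      rw [h1, ← T.length_leaves, ← U.length_leaves, h.length_eq]
    have hW : us.length = W.numLeaves := by
      rw [h2, ← V.length_leaves, ← W.length_leaves, h'.length_eq]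
    have e1 := BinTree.forall₂_expand EvenMove.append h ts
    have e2 := BinTree.forall₂_expand EvenMove.append h' us
    rw [← BinTree.leaves_graft _ _ hT, ← BinTree.leaves_graft _ _ h1, h3] at e1
    rw [← BinTree.leaves_graft _ _ h2, ← BinTree.leaves_graft _ _ hW] at e2
    refine ⟨T.graft ts, W.graft us, BinTree.forall₂_trans ?_ e1 e2⟩
    intro α β γ hab hbc
    exact ⟨fun s => by rw [ThompsonF.mul_apply, hab.1, hbc.1], hab.2.trans hbc.2⟩
  inv_mem' := by
    intro f hf
    rw [Set.mem_ofPred_eq, exists_colorable_iff] at hf ⊢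
    obtain ⟨T, U, h⟩ := hf
    refine ⟨U, T, h.flip.imp fun α β hab => ⟨fun s => ?_, hab.2.symm⟩⟩
    change f.1.symm _ = _
    rw [← hab.1, Homeomorph.symm_apply_apply]

theorem wordPoint_length (w : List Bool) :
    (wordPoint w 1 : ℝ) - (wordPoint w 0 : ℝ) = (1 / 2) ^ w.length := by
  induction w with
  | nil => simp [wordPoint]
  | cons b w ih =>
    rw [List.length_cons, pow_succ, ← ih]
    simp only [wordPoint]
    ring

theorem wordSign_eq_of_wordPoint {v w : List Bool} (h : ∀ s, wordPoint v s = wordPoint w s) :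
    wordSign v = wordSign w := by
  have h1 := wordPoint_length v
  rw [h, h, wordPoint_length w] at h1
  have h2 := (pow_right_injective₀ (a := (1 / 2 : ℝ)) (by norm_num) (by norm_num)) h1
  rw [wordSign, wordSign, h2]

theorem BinTree.sign_of_expand (L M : List (List Bool)) (ts : List BinTree)
    (h : L.length = M.length) (hts : ts.length = L.length)
    (he : (expand L ts).map wordSign = (expand M ts).map wordSign) :
    L.map wordSign = M.map wordSign := by
  have : Fact (Nat.Prime 3) := ⟨by norm_num⟩
  induction L generalizing M ts with
  | nil => rw [List.length_eq_zero_iff.mp h.symm]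
  | cons α L ih =>
    cases M with
    | nil => simp at h
    | cons β M =>
      cases ts with
      | nil => simp at hts
      | cons t ts =>
        simp only [expand, List.map_append, List.map_map] at he
        obtain ⟨h1, h2⟩ := List.append_inj he (by simp)
        rw [List.map_cons, List.map_cons,
          ih M ts (by simpa using h) (by simpa using hts) h2]
        congr 1
        obtain ⟨w, hw⟩ : ∃ w, w ∈ t.leaves := List.exists_mem_of_length_pos
          (by rw [t.length_leaves]; exact t.numLeaves_pos)
        have h3 := List.map_inj_left.mp h1 w hw
        simp only [Function.comp_apply, wordSign_append] at h3
        exact mul_right_cancel₀ (wordSign_ne_zero w) h3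

/-- Membership may be tested on any tree diagram of the element, for example on the reduced one. -/
theorem mem_threeColorableSubgroup_iff (f : ThompsonF) (D : TreeDiagram) (hD : D.Represents f.1) :
    f ∈ threeColorableSubgroup ↔ D.stripGraph.Colorable 3 := by
  refine ⟨fun hf => ?_, fun h => ⟨D, hD, h⟩⟩
  obtain ⟨T, U, h⟩ := (exists_colorable_iff f.1).mp hf
  obtain ⟨ts, us, h1, h2, h3⟩ := D.top.exists_common_graft T
  have e1 := BinTree.forall₂_expand
    (R := fun α β => ∀ s : I, f.1 (wordPoint α s) = wordPoint β s)
    (fun α β w hab s => by rw [wordPoint_append, wordPoint_append, hab]) hD ts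
  have e2 := BinTree.forall₂_expand EvenMove.append h us
  have e3 : BinTree.expand D.top.leaves ts = BinTree.expand T.leaves us := by
    rw [← BinTree.leaves_graft _ _ h1, ← BinTree.leaves_graft _ _ h2, h3]
  rw [← e3] at e2
  have e4 : (BinTree.expand D.top.leaves ts).map wordSign =
      (BinTree.expand D.bottom.leaves ts).map wordSign := by
    rw [← List.forall₂_eq_eq_eq, List.forall₂_map_left_iff, List.forall₂_map_right_iff]
    rw [List.forall₂_iff_get] at e1 e2 ⊢
    refine ⟨e1.1, fun i hi hi' => ?_⟩
    have hi2 : i < (BinTree.expand U.leaves us).length := e2.1 ▸ hi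
    rw [(e2.2 i hi hi2).2]
    apply wordSign_eq_of_wordPoint
    intro s
    rw [← (e2.2 i hi hi2).1, e1.2 i hi hi']
  rw [TreeDiagram.colorable_iff]
  exact BinTree.sign_of_expand _ _ ts
    (by rw [BinTree.length_leaves, BinTree.length_leaves, D.numLeaves_eq])
    (by rw [h1, BinTree.length_leaves]) e4

/-! ### Quasi-regular representations -/

/-- The Hilbert space `ℓ²(X)` of square-summable functions `X → ℂ`. -/
abbrev ell2 (X : Type*) : Type _ := lp (fun _ : X => ℂ) 2

theorem memℓp_two_comp_perm {X : Type*} (e : Equiv.Perm X) (ξ : ell2 X) :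
    Memℓp (fun x => ξ (e x)) 2 := by
  have h : 0 < (2 : ℝ≥0∞).toReal := by norm_num
  rw [memℓp_gen_iff h]
  exact e.summable_iff.mpr ((memℓp_gen_iff h).mp (lp.memℓp ξ))

/-- A permutation `e` of `X` acts on `ℓ²(X)` by the unitary operator `ξ ↦ ξ ∘ e⁻¹`. -/
def ell2Perm (X : Type*) : Equiv.Perm X →* (ell2 X ≃ₗᵢ[ℂ] ell2 X) where
  toFun e :=
    { toFun := fun ξ => ⟨fun x => ξ (e.symm x), memℓp_two_comp_perm e.symm ξ⟩
      invFun := fun ξ => ⟨fun x => ξ (e x), memℓp_two_comp_perm e ξ⟩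
      map_add' := fun _ _ => rfl
      map_smul' := fun _ _ => rfl
      left_inv := fun ξ => by ext x; simp
      right_inv := fun ξ => by ext x; simp
      norm_map' := fun ξ => by
        have h : 0 < (2 : ℝ≥0∞).toReal := by norm_num
        rw [lp.norm_eq_tsum_rpow h, lp.norm_eq_tsum_rpow h]
        congr 1
        exact e.symm.tsum_eq (fun x => ‖ξ x‖ ^ (2 : ℝ≥0∞).toReal) }
  map_one' := rfl
  map_mul' _ _ := rfl

/-- The quasi-regular representation of `G` on `ℓ²(G/H)`: `(π(g) ξ)(x) = ξ(g⁻¹ x)`. -/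
def quasiRegular {G : Type*} [Group G] (H : Subgroup G) :
    G →* (ell2 (G ⧸ H) ≃ₗᵢ[ℂ] ell2 (G ⧸ H)) :=
  (ell2Perm (G ⧸ H)).comp (MulAction.toPermHom G (G ⧸ H))

theorem quasiRegular_apply {G : Type*} [Group G] (H : Subgroup G) (g : G) (ξ : ell2 (G ⧸ H))
    (x : G ⧸ H) : quasiRegular H g ξ x = ξ (g⁻¹ • x) := rfl

/-- A unitary representation is irreducible when its Hilbert space is nonzero and has no closed
invariant subspaces other than zero and the whole space. -/
def IsIrreducibleUnitary {G E : Type*} [Group G] [NormedAddCommGroup E] [InnerProductSpace ℂ E]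
    (π : G →* (E ≃ₗᵢ[ℂ] E)) : Prop :=
  Nontrivial E ∧ ∀ K : Submodule ℂ E, IsClosed (K : Set E) →
    (∀ g : G, ∀ v ∈ K, π g v ∈ K) → K = ⊥ ∨ K = ⊤

end

/-! ### Irreducibility of quasi-regular representations -/

/-! Write `H` for the 3-colorable subgroup. The proof combines a Mackey-type criterion with a
dynamical description of `H`.

Criterion (`isIrreducibleUnitary_quasiRegular_of_forall_pow`): suppose that every coset `gH ≠ H` has
an infinite orbit under some element of `H`. The orthogonal projection to an invariant closed
subspace `K` commutes with the representation, so it sends the delta function of the base coset to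
an `H`-invariant vector. Square summability kills this vector on infinite orbits, so it is a
multiple of the delta function. Hence that delta function, which generates the whole space, lies in
`K` or is orthogonal to `K`.

Description (`mem_threeColorableSubgroup_iff_hasSlopeParity`): a leaf of depth `m` matched with a
leaf of depth `n` gives slope `2 ^ (m - n)`, so equal depth parities mean that all slopes are powers
of `4`.

One element serves all cosets: `ThompsonF.pushRight` lies in `H` and moves every point of `(0, 1)`
to the right, as do its positive powers `φ`. If `φ` fixes `gH`, the chain rule makes the slope
parity of `g` invariant under `φ`. This parity is constant near `0`, and backward orbits of `φ` tend
to `0`, so it is constant on `[0, 1)`. It is not odd, by counting lengths modulo `3`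
(`BinTree.sum_wordSign`), so it is even and `g ∈ H`. -/

theorem lp.eq_zero_of_injective_of_forall_eq {X : Type*} (ξ : ell2 X) (u : ℕ → X)
    (hu : Function.Injective u) (c : ℂ) (h : ∀ n, ξ (u n) = c) : c = 0 := by
  have h2 : 0 < (2 : ℝ≥0∞).toReal := by norm_num
  have hs := ((memℓp_gen_iff h2).mp (lp.memℓp ξ)).comp_injective hu
  simp only [Function.comp_def, h, ENNReal.toReal_ofNat, Real.rpow_ofNat] at hs
  have := tendsto_nhds_unique tendsto_const_nhds hs.tendsto_atTop_zero
  simpa using this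

theorem isIrreducibleUnitary_quasiRegular_of_forall_pow {G : Type*} [Group G] (H : Subgroup G)
    (hH : ∀ g ∉ H, ∃ h ∈ H, ∀ n : ℕ, 0 < n → h ^ n • (g : G ⧸ H) ≠ g) :
    IsIrreducibleUnitary (quasiRegular H) := by
  classical
  set x₀ : G ⧸ H := ((1 : G) : G ⧸ H) with hx₀
  let e : ell2 (G ⧸ H) := lp.single 2 x₀ 1
  have he : ∀ x, e x = if x = x₀ then 1 else 0 := fun x => by
    simp [e, lp.single_apply, Pi.single_apply]
  have hstab : ∀ h ∈ H, h • x₀ = x₀ := fun h hh => by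
    rw [hx₀, MulAction.Quotient.smul_coe, QuotientGroup.eq]
    simpa using hh
  refine ⟨⟨e, 0, fun h => ?_⟩, fun K hK hinv => ?_⟩
  · have := congrArg (fun ξ : ell2 (G ⧸ H) => ξ x₀) h
    simp [he] at this
  have : CompleteSpace K := hK.completeSpace_coe
  have hperp : ∀ g : G, ∀ v ∈ Kᗮ, quasiRegular H g v ∈ Kᗮ := by
    intro g v hv w hw
    have h1 := hv _ (hinv g⁻¹ w hw)
    have h2 : quasiRegular H g (quasiRegular H g⁻¹ w) = w := by
      ext x
      simp
    rwa [← (quasiRegular H g).inner_map_map, h2] at h1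
  -- `u` is the projection of `e` to `K`. As `H` fixes `e`, uniqueness of the decomposition shows
  -- that `H` fixes `u`.
  obtain ⟨u, hu, w, hw, huw⟩ := K.exists_add_mem_mem_orthogonal e
  have hfix : ∀ h ∈ H, quasiRegular H h u = u := by
    intro h hh
    have h1 : quasiRegular H h e = e := by
      ext x
      rw [quasiRegular_apply, he, he]
      exact if_congr (by rw [inv_smul_eq_iff, hstab h hh]) rfl rfl
    have h2 : quasiRegular H h u - u = w - quasiRegular H h w := by
      rw [huw, map_add] at h1
      rw [sub_eq_sub_iff_add_eq_add, h1, add_comm]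
    have h3 : quasiRegular H h u - u ∈ K ⊓ Kᗮ :=
      ⟨K.sub_mem (hinv h u hu) hu, h2 ▸ Kᗮ.sub_mem hw (hperp h w hw)⟩
    rw [K.inf_orthogonal_eq_bot, Submodule.mem_bot, sub_eq_zero] at h3
    exact h3
  have hconst : ∀ h ∈ H, ∀ x, u (h • x) = u x := by
    intro h hh x
    have := congrArg (fun ξ : ell2 (G ⧸ H) => ξ (h • x)) (hfix h hh)
    simpa [quasiRegular_apply] using this.symm
  have hzero : ∀ x, x ≠ x₀ → u x = 0 := by
    intro x
    induction x using QuotientGroup.induction_on with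
    | H g =>
      intro hg
      have hgH : g ∉ H := fun h => hg (by
        rw [hx₀, QuotientGroup.eq]; simpa using h)
      obtain ⟨h, hh, hn⟩ := hH g hgH
      -- `u` is constant along this orbit, which is infinite because no positive power of `h` fixes
      -- the coset.
      refine lp.eq_zero_of_injective_of_forall_eq u (fun n => h ^ n • (g : G ⧸ H)) ?_ _
        (fun n => hconst _ (H.pow_mem hh n) _)
      refine Function.Injective.of_lt_imp_ne fun m n hmn heq => hn (n - m) (by omega) ?_
      have h1 : h ^ n = h ^ m * h ^ (n - m) := by rw [← pow_add]; congr 1; omega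
      simp only [h1, mul_smul, smul_left_cancel_iff] at heq
      exact heq.symm
  have hue : u = u x₀ • e := by
    ext x
    by_cases hx : x = x₀
    · simp [he, hx]
    · simp [he, hx, hzero x hx]
  by_cases hc : u x₀ = 0
  · left
    rw [hc, zero_smul] at hue
    rw [hue, zero_add] at huw
    refine (Submodule.eq_bot_iff K).mpr fun v hv => ?_
    ext x
    induction x using QuotientGroup.induction_on with
    | H g =>
      -- Here `e` is orthogonal to `K`, and its inner product with the translate of `v` by `g⁻¹`
      -- reads off the value of `v` at the coset of `g`.
      have h1 := hw _ (hinv g⁻¹ v hv)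
      rw [← huw, lp.inner_single_right, quasiRegular_apply, inv_inv, hx₀,
        MulAction.Quotient.smul_coe, smul_eq_mul, mul_one] at h1
      simpa using h1
  · right
    have heK : e ∈ K := by
      rw [hue] at hu
      exact (K.smul_mem_iff hc).mp hu
    have hsingle : ∀ x, lp.single 2 x (1 : ℂ) ∈ K := by
      intro x
      induction x using QuotientGroup.induction_on with
      | H g =>
        have h1 := hinv g e heK
        convert h1 using 1
        ext y
        have h2 : g⁻¹ • y = x₀ ↔ y = g := by
          rw [inv_smul_eq_iff, hx₀, MulAction.Quotient.smul_coe, smul_eq_mul, mul_one]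
        rw [quasiRegular_apply, he]
        simp only [h2]
        simp [lp.single_apply, Pi.single_apply]
    refine (Submodule.eq_top_iff').mpr fun v => ?_
    have hs := lp.hasSum_single (p := 2) (by norm_num) v
    refine hK.mem_of_tendsto hs (Filter.Eventually.of_forall fun s => K.sum_mem fun x _ => ?_)
    have : lp.single 2 x (v x) = v x • lp.single (E := fun _ : G ⧸ H => ℂ) 2 x (1 : ℂ) := by
      rw [← lp.single_smul]; simp
    rw [this]
    exact K.smul_mem _ (hsingle x)

/-! ### Standard dyadic intervals -/

theorem wordPoint_cons (b : Bool) (w : List Bool) (s : I) :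
    (wordPoint (b :: w) s : ℝ) = ((if b then 1 else 0) + (wordPoint w s : ℝ)) / 2 := rfl

theorem wordPoint_eq (w : List Bool) (s : I) :
    (wordPoint w s : ℝ) = (wordPoint w 0 : ℝ) + (2 : ℝ) ^ (-(w.length : ℤ)) * s := by
  induction w with
  | nil => simp [wordPoint]
  | cons b w ih =>
    rw [wordPoint_cons, wordPoint_cons, ih, List.length_cons, Nat.cast_succ, neg_add,
      zpow_add₀ two_ne_zero, zpow_neg_one]
    ring

theorem wordPoint_zero_lt_one (w : List Bool) : (wordPoint w 0 : ℝ) < wordPoint w 1 := by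
  have := wordPoint_eq w 1
  have h : (0 : ℝ) < (2 : ℝ) ^ (-(w.length : ℤ)) := by positivity
  simp only [Set.Icc.coe_one, mul_one] at this
  linarith

/-- `j` is the integer with binary digits `w`. -/
theorem wordPoint_eq_div (w : List Bool) :
    ∃ j : ℕ, ∀ s : I, (wordPoint w s : ℝ) = (j + s) / 2 ^ w.length := by
  induction w with
  | nil => exact ⟨0, by simp [wordPoint]⟩
  | cons b w ih =>
    obtain ⟨j, hj⟩ := ih
    refine ⟨(if b then 2 ^ w.length else 0) + j, fun s => ?_⟩
    rw [wordPoint_cons, hj, List.length_cons, pow_succ]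
    cases b
    · simp; field_simp
    · simp; field_simp; ring

theorem exists_wordPoint_eq (p c : ℕ) (hc : c < 2 ^ p) :
    ∃ v : List Bool, v.length = p ∧ ∀ s : I, (wordPoint v s : ℝ) = (c + s) / 2 ^ p := by
  induction p generalizing c with
  | zero =>
    obtain rfl : c = 0 := by simpa using hc
    exact ⟨[], rfl, by simp [wordPoint]⟩
  | succ p ih =>
    rw [pow_succ] at hc
    by_cases h : c < 2 ^ p
    · obtain ⟨v, hv, hs⟩ := ih c h
      refine ⟨false :: v, by simp [hv], fun s => ?_⟩
      rw [wordPoint_cons, hs, pow_succ]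
      simp; field_simp
    · obtain ⟨v, hv, hs⟩ := ih (c - 2 ^ p) (by omega)
      refine ⟨true :: v, by simp [hv], fun s => ?_⟩
      rw [wordPoint_cons, hs, pow_succ, Nat.cast_sub (by omega)]
      push_cast
      simp; field_simp; ring

/-- The half-open leaf intervals cover `[0, 1)`. Having `s < 1` leaves room to the right of `t`
inside the leaf, as right slopes require. -/
theorem BinTree.exists_leaf_wordPoint_eq (T : BinTree) (t : I) (ht : t < 1) :
    ∃ w ∈ T.leaves, ∃ s < 1, t = wordPoint w s := by
  induction T generalizing t with
  | leaf => exact ⟨[], by simp [leaves], t, ht, rfl⟩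
  | node l r hl hr =>
    have ht' : (t : ℝ) < 1 := ht
    have h0 := t.2.1
    by_cases h : (t : ℝ) < 1 / 2
    · obtain ⟨w, hw, s, hs, hts⟩ := hl ⟨2 * t, by constructor <;> linarith⟩
        (Subtype.mk_lt_mk.mpr (by linarith))
      refine ⟨false :: w, by simp [leaves, hw], s, hs, Subtype.ext ?_⟩
      rw [wordPoint_cons, ← hts]
      simp
    · obtain ⟨w, hw, s, hs, hts⟩ := hr ⟨2 * t - 1, by constructor <;> linarith⟩
        (Subtype.mk_lt_mk.mpr (by linarith))
      refine ⟨true :: w, by simp [leaves, hw], s, hs, Subtype.ext ?_⟩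
      rw [wordPoint_cons, ← hts]
      simp

/-- Modulo `3` one has `1 / 2 = -1`, so `wordSign w` is the length of the interval of `w`, and these
lengths add up to that of `[0, 1]`. -/
theorem BinTree.sum_wordSign (T : BinTree) : (T.leaves.map wordSign).sum = 1 := by
  induction T with
  | leaf => simp [leaves, wordSign]
  | node l r hl hr =>
    have h (L : List (List Bool)) :
        (L.map fun w => - wordSign w).sum = - (L.map wordSign).sum := by
      rw [List.sum_neg, List.map_map]; rfl
    simp only [leaves, List.map_append, List.map_map, Function.comp_def, wordSign_cons,
      List.sum_append, h, hl, hr]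
    decide

/-! ### Tilings by standard dyadic intervals -/

/-- The intervals of the words of the list are adjacent, from left to right, and fill `[a, b]`. -/
def Tiles : List (List Bool) → ℝ → ℝ → Prop
  | [], a, b => a = b
  | w :: L, a, b => (wordPoint w 0 : ℝ) = a ∧ Tiles L (wordPoint w 1) b

theorem Tiles.le {L : List (List Bool)} {a b : ℝ} (h : Tiles L a b) : a ≤ b := by
  induction L generalizing a with
  | nil => exact le_of_eq h
  | cons w L ih => rw [← h.1]; exact (wordPoint_zero_lt_one w).le.trans (ih h.2)

theorem Tiles.append {L M : List (List Bool)} {a b c : ℝ} (h : Tiles L a b) (h' : Tiles M b c) :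
    Tiles (L ++ M) a c := by
  induction L generalizing a with
  | nil => exact (show a = b from h) ▸ h'
  | cons w L ih => exact ⟨h.1, ih h.2⟩

theorem Tiles.map_cons (d : Bool) {L : List (List Bool)} {a b : ℝ} (h : Tiles L a b) :
    Tiles (L.map (List.cons d)) (((if d then 1 else 0) + a) / 2)
      (((if d then 1 else 0) + b) / 2) := by
  induction L generalizing a with
  | nil => rw [show a = b from h]; rfl
  | cons w L ih => exact ⟨by rw [wordPoint_cons, h.1], ih h.2⟩

theorem BinTree.tiles_leaves (T : BinTree) : Tiles T.leaves 0 1 := by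
  induction T with
  | leaf => exact ⟨by simp [wordPoint], by simp [wordPoint, Tiles]⟩
  | node l r hl hr =>
    have h1 := hl.map_cons false
    have h2 := hr.map_cons true
    norm_num at h1 h2
    exact h1.append h2

theorem Tiles.exists_map_cons_true {L : List (List Bool)} {a b : ℝ} (h : Tiles L a b)
    (ha : 1 / 2 ≤ a) (hL : [] ∉ L) :
    ∃ M, L = M.map (List.cons true) ∧ Tiles M (2 * a - 1) (2 * b - 1) := by
  induction L generalizing a with
  | nil => exact ⟨[], rfl, by rw [show a = b from h]; rfl⟩
  | cons w L ih =>
    obtain ⟨h1, h2⟩ := h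
    have hlt := wordPoint_zero_lt_one w
    obtain ⟨M, rfl, hM⟩ := ih h2 (by linarith) (fun h => hL (List.mem_cons_of_mem _ h))
    rcases w with _ | ⟨_ | _, w⟩
    · simp at hL
    · have h3 := (wordPoint w 1).2.2
      rw [h1, wordPoint_cons] at hlt
      simp at hlt
      linarith
    · refine ⟨w :: M, rfl, ?_, ?_⟩
      · rw [wordPoint_cons] at h1
        simp at h1
        linarith
      · rw [wordPoint_cons] at hM
        simp only [if_true] at hM
        convert hM using 1
        ring

/-- Apart from `[0, 1]` itself, no standard dyadic interval has `1 / 2` in its interior. The tiling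
therefore breaks there, and each half is rescaled by dropping first letters. -/
theorem Tiles.exists_split {L : List (List Bool)} {a b : ℝ} (h : Tiles L a b)
    (ha : a ≤ 1 / 2) (hb : 1 / 2 ≤ b) (hL : [] ∉ L) :
    ∃ M N, L = M.map (List.cons false) ++ N.map (List.cons true) ∧
      Tiles M (2 * a) 1 ∧ Tiles N 0 (2 * b - 1) := by
  induction L generalizing a with
  | nil =>
    have h' : a = b := h
    refine ⟨[], [], rfl, ?_, ?_⟩
    · change 2 * a = 1; linarith
    · change 0 = 2 * b - 1; linarith
  | cons w L ih =>
    rcases w with _ | ⟨_ | _, w⟩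
    · simp at hL
    · obtain ⟨h1, h2⟩ := h
      rw [wordPoint_cons] at h1 h2
      simp only [Bool.false_eq_true, if_false, zero_add] at h1 h2
      have h3 := (wordPoint w 1).2.2
      obtain ⟨M, N, rfl, hM, hN⟩ := ih h2 (by linarith)
        (fun h => hL (List.mem_cons_of_mem _ h))
      refine ⟨w :: M, N, rfl, ⟨by linarith, ?_⟩, hN⟩
      convert hM using 1
      ring
    · have h1 := h.1
      have h3 := (wordPoint w 0).2.1
      rw [wordPoint_cons] at h1
      simp only [if_true] at h1
      obtain rfl : a = 1 / 2 := by linarith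
      obtain ⟨N, hN, hN'⟩ := h.exists_map_cons_true le_rfl hL
      refine ⟨[], N, hN, ?_, ?_⟩
      · change 2 * (1 / 2 : ℝ) = 1; norm_num
      · convert hN' using 1; norm_num

theorem Tiles.eq_of_nil_mem {L : List (List Bool)} {a b : ℝ} (h : Tiles L a b) (ha : 0 ≤ a)
    (hb : b ≤ 1) (hL : [] ∈ L) : L = [[]] := by
  induction L generalizing a with
  | nil => simp at hL
  | cons w L ih =>
    obtain ⟨h1, h2⟩ := h
    have h3 := wordPoint_zero_lt_one w
    by_cases hw : [] ∈ L
    · have h4 := ih h2 (by linarith) hw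
      subst h4
      have h5 := h2.1
      simp only [wordPoint, Set.Icc.coe_zero] at h5
      linarith
    · obtain rfl : w = [] := by
        rcases List.mem_cons.mp hL with h | h
        · exact h.symm
        · exact absurd h hw
      cases L with
      | nil => rfl
      | cons v L =>
        have h4 := wordPoint_zero_lt_one v
        have h5 := h2.2.le
        have h6 := h2.1
        simp only [wordPoint, Set.Icc.coe_one] at h6
        linarith

/-- Standard dyadic intervals that tile `[0, 1]` are the leaves of a tree. -/
theorem Tiles.exists_leaves_eq {L : List (List Bool)} (h : Tiles L 0 1) :
    ∃ T : BinTree, T.leaves = L := by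
  -- The total length of the words drops, because each half is non-empty and each of its words loses
  -- a letter.
  induction hn : (L.map List.length).sum using Nat.strong_induction_on generalizing L with
  | _ n ih =>
    by_cases hL : [] ∈ L
    · exact ⟨BinTree.leaf, (h.eq_of_nil_mem le_rfl le_rfl hL).symm⟩
    · obtain ⟨M, N, rfl, hM, hN⟩ := h.exists_split (by norm_num) (by norm_num) hL
      norm_num at hM hN
      have hM0 : 0 < M.length := by
        cases M with
        | nil => exact absurd (show (0 : ℝ) = 1 from hM) zero_ne_one
        | cons => simp
      have hN0 : 0 < N.length := by
        cases N with
        | nil => exact absurd (show (0 : ℝ) = 1 from hN) zero_ne_one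
        | cons => simp
      simp [Function.comp_def, List.sum_map_add] at hn
      obtain ⟨T, rfl⟩ := ih _ (by omega) hM rfl
      obtain ⟨U, rfl⟩ := ih _ (by omega) hN rfl
      exact ⟨BinTree.node T U, rfl⟩

/-! ### Every element of `F` has a tree diagram -/

/-- `f` maps the interval of `w` affinely onto a standard dyadic interval. -/
def MapsToStandard (f : I ≃ₜ I) (w : List Bool) : Prop :=
  ∃ v, ∀ s, f (wordPoint w s) = wordPoint v s

theorem Tiles.exists_forall₂ {f : I ≃ₜ I} {L : List (List Bool)} {a b : I}
    (h : Tiles L a b) (hL : ∀ w ∈ L, MapsToStandard f w) :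
    ∃ M, List.Forall₂ (fun α β => ∀ s : I, f (wordPoint α s) = wordPoint β s) L M ∧
      Tiles M (f a) (f b) := by
  induction L generalizing a with
  | nil => exact ⟨[], List.Forall₂.nil, by rw [Subtype.ext (show (a : ℝ) = b from h)]; rfl⟩
  | cons w L ih =>
    obtain ⟨h1, h2⟩ := h
    obtain ⟨v, hv⟩ := hL w List.mem_cons_self
    obtain ⟨M, hM, hM'⟩ := ih h2 fun w' hw' => hL w' (List.mem_cons_of_mem _ hw')
    refine ⟨v :: M, List.Forall₂.cons hv hM, ?_, ?_⟩
    · rw [← hv, Subtype.ext h1]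
    · rw [← hv]; exact hM'

/-- The tree is the full binary tree of depth `n` with the given trees grafted onto its leaves. -/
theorem exists_tree_of_forall_length {P : List Bool → Prop} (n : ℕ) (w : List Bool)
    (h : ∀ u : List Bool, u.length = n → ∃ T : BinTree, ∀ v ∈ T.leaves, P (w ++ u ++ v)) :
    ∃ T : BinTree, ∀ v ∈ T.leaves, P (w ++ v) := by
  induction n generalizing w with
  | zero => simpa using h [] rfl
  | succ n ih =>
    have key (b : Bool) : ∃ T : BinTree, ∀ v ∈ T.leaves, P (w ++ [b] ++ v) :=
      ih (w ++ [b]) fun u hu => by simpa using h (b :: u) (by simp [hu])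
    obtain ⟨T, hT⟩ := key false
    obtain ⟨U, hU⟩ := key true
    refine ⟨BinTree.node T U, fun v hv => ?_⟩
    simp only [BinTree.leaves, List.mem_append, List.mem_map] at hv
    rcases hv with ⟨v, hv, rfl⟩ | ⟨v, hv, rfl⟩
    · simpa using hT v hv
    · simpa using hU v hv

/-- An interval in `[0, 1]` is standard when its length is `2 ^ (-N)` and its left end is an integer
multiple of that length. The depth of `u` makes `N = m + q` at least `m`, so the denominator of `a /
2 ^ m` is absorbed. -/
theorem mapsToStandard_of_affine {f : I ≃ₜ I} {w : List Bool} {k : ℤ} {a : ℤ} {m : ℕ}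
    (hf : ∀ s, (f (wordPoint w s) : ℝ) = a / 2 ^ m + (2 : ℝ) ^ k * s) {u : List Bool}
    (hu : u.length = m + k.toNat) : MapsToStandard f (w ++ u) := by
  obtain ⟨j, hj⟩ := wordPoint_eq_div u
  obtain ⟨q, hq⟩ : ∃ q : ℕ, (u.length : ℤ) - k = m + q :=
    ⟨(k.toNat - k).toNat, by omega⟩
  have hpow : (2 : ℝ) ^ k = 2 ^ u.length / 2 ^ (m + q) := by
    rw [← zpow_natCast, ← zpow_natCast, ← zpow_sub₀ two_ne_zero]
    congr 1
    push_cast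
    omega
  have hfs : ∀ s, (f (wordPoint (w ++ u) s) : ℝ) =
      (((a * 2 ^ q + j : ℤ) : ℝ) + s) / 2 ^ (m + q) := by
    intro s
    rw [wordPoint_append, hf, hj, hpow, pow_add]
    push_cast
    field_simp
    ring
  have h0 := (f (wordPoint (w ++ u) 0)).2.1
  have h1 := (f (wordPoint (w ++ u) 1)).2.2
  rw [hfs, Set.Icc.coe_zero, add_zero, le_div_iff₀ (by positivity), zero_mul] at h0
  rw [hfs, Set.Icc.coe_one, div_le_one (by positivity)] at h1
  have h0' : 0 ≤ a * 2 ^ q + j := by exact_mod_cast h0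
  obtain ⟨c, hc⟩ := Int.eq_ofNat_of_zero_le h0'
  rw [hc] at h1 hfs
  obtain ⟨v, -, hv⟩ := exists_wordPoint_eq (m + q) c (by
    have : c + 1 ≤ 2 ^ (m + q) := by exact_mod_cast h1
    omega)
  exact ⟨v, fun s => Subtype.ext (by rw [hfs, hv]; simp)⟩

theorem IsDyadic.exists_forall_le_eq_div {ι : Type*} (S : Finset ι) (x : ι → ℝ)
    (hS : ∀ s ∈ S, IsDyadic (x s)) :
    ∃ n : ℕ, ∀ s ∈ S, ∃ a : ℤ, x s = a / 2 ^ n := by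
  classical
  induction S using Finset.induction_on with
  | empty => exact ⟨0, by simp⟩
  | insert s S _ ih =>
    obtain ⟨n, hn⟩ := ih fun s hs => hS s (Finset.mem_insert_of_mem hs)
    obtain ⟨a, m, ha⟩ := hS s (Finset.mem_insert_self _ _)
    refine ⟨m + n, fun r hr => ?_⟩
    rcases Finset.mem_insert.mp hr with rfl | hr
    · exact ⟨a * 2 ^ n, by rw [ha, pow_add]; push_cast; field_simp⟩
    · obtain ⟨b, hb⟩ := hn r hr
      exact ⟨b * 2 ^ m, by rw [hb, pow_add]; push_cast; field_simp⟩

/-- At a depth `n` where all breakpoints are multiples of `2 ^ (-n)`, `f` is affine on each standard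
interval. Subdividing these further makes the images standard. The images tile `[0, 1]`, hence are
the leaves of the bottom tree. -/
theorem IsThompson.exists_represents {f : I ≃ₜ I} (hf : IsThompson f) :
    ∃ D : TreeDiagram, D.Represents f := by
  have hz := hf.map_zero
  have hone : f 1 = 1 := le_antisymm unitInterval.le_one' (by
    calc (1 : I) = f (f.symm 1) := by simp
      _ ≤ f 1 := hf.strictMono.monotone unitInterval.le_one')
  have hmap := hf.dyadic_map
  obtain ⟨S, hd, hS⟩ := hf
  obtain ⟨n, hn⟩ := IsDyadic.exists_forall_le_eq_div S (fun s => (s : ℝ)) hd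
  obtain ⟨T, hT⟩ : ∃ T : BinTree, ∀ v ∈ T.leaves, MapsToStandard f ([] ++ v) := by
    refine exists_tree_of_forall_length n [] fun u hu => ?_
    obtain ⟨j, hj⟩ := wordPoint_eq_div u
    have hlt : wordPoint u 0 < wordPoint u 1 := wordPoint_zero_lt_one u
    obtain ⟨k, hk⟩ := hS _ _ hlt fun s hs hs' => by
      obtain ⟨c, hc⟩ := hn s hs
      have h1 : (wordPoint u 0 : ℝ) < s := hs'.1
      have h2 : (s : ℝ) < wordPoint u 1 := hs'.2
      rw [hj, hu, hc, div_lt_div_iff_of_pos_right (by positivity)] at h1 h2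
      simp only [Set.Icc.coe_zero, Set.Icc.coe_one, add_zero] at h1 h2
      have h1' : (j : ℤ) < c := by exact_mod_cast h1
      have h2' : c < (j : ℤ) + 1 := by exact_mod_cast h2
      omega
    obtain ⟨a, m, ham⟩ := hmap (wordPoint u 0) ⟨j, u.length, by rw [hj]; simp⟩
    -- The exponent is shifted by `u.length` because `s` is the rescaled coordinate on the interval
    -- of `u`.
    have haff : ∀ s, (f (wordPoint u s) : ℝ) =
        a / 2 ^ m + (2 : ℝ) ^ (k - u.length) * s := by
      intro s
      have hs : wordPoint u s ∈ Set.Icc (wordPoint u 0) (wordPoint u 1) := by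
        have h0 := s.2.1
        have h1 := s.2.2
        constructor
        · change (wordPoint u 0 : ℝ) ≤ wordPoint u s
          rw [hj, hj]; gcongr; exact h0
        · change (wordPoint u s : ℝ) ≤ wordPoint u 1
          rw [hj, hj]; gcongr; exact h1
      rw [hk _ hs, ham, wordPoint_eq u s, sub_eq_add_neg k, zpow_add₀ two_ne_zero]
      ring
    refine exists_tree_of_forall_length (m + (k - u.length).toNat) ([] ++ u)
      fun v hv => ⟨BinTree.leaf, fun v' hv' => ?_⟩
    obtain rfl : v' = [] := by simpa [BinTree.leaves] using hv'
    simpa using mapsToStandard_of_affine haff hv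
  simp only [List.nil_append] at hT
  obtain ⟨M, hM, hM'⟩ := Tiles.exists_forall₂ (a := 0) (b := 1)
    (by simpa using T.tiles_leaves) hT
  rw [hz, hone] at hM'
  obtain ⟨U, rfl⟩ := Tiles.exists_leaves_eq (L := M) (by simpa using hM')
  exact ⟨⟨T, U, by rw [← T.length_leaves, ← U.length_leaves, hM.length_eq]⟩, hM⟩

/-! ### Parities of slopes -/

/-- To the right of `t`, the map `f` is affine with slope `2 ^ k`, where `k` has parity `p`. -/
def HasSlopeParity (f : I ≃ₜ I) (t : I) (p : ZMod 2) : Prop :=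
  ∃ b, t < b ∧ ∃ k : ℤ, (k : ZMod 2) = p ∧
    ∀ x ∈ Set.Icc t b, (f x : ℝ) = (f t : ℝ) + (2 : ℝ) ^ k * ((x : ℝ) - t)

theorem HasSlopeParity.unique {f : I ≃ₜ I} {t : I} {p q : ZMod 2} (hp : HasSlopeParity f t p)
    (hq : HasSlopeParity f t q) : p = q := by
  obtain ⟨b, hb, k, rfl, hk⟩ := hp
  obtain ⟨c, hc, l, rfl, hl⟩ := hq
  have hlt : t < min b c := lt_min hb hc
  have h1 := hk (min b c) ⟨hlt.le, min_le_left _ _⟩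
  rw [hl (min b c) ⟨hlt.le, min_le_right _ _⟩] at h1
  have h2 : ((min b c : I) : ℝ) - t ≠ 0 := (sub_pos.mpr (show (t : ℝ) < (min b c : I) from hlt)).ne'
  have h3 := mul_right_cancel₀ h2 (add_left_cancel h1)
  rw [zpow_right_injective₀ two_pos (by norm_num) h3]

theorem HasSlopeParity.trans {f g : I ≃ₜ I} {t : I} {p q : ZMod 2} (hf : StrictMono f)
    (hp : HasSlopeParity f t p) (hq : HasSlopeParity g (f t) q) :
    HasSlopeParity (f.trans g) t (p + q) := by
  obtain ⟨b, hb, k, rfl, hk⟩ := hp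
  obtain ⟨c, hc, l, rfl, hl⟩ := hq
  refine ⟨min b (f.symm c), lt_min hb ?_, k + l, by push_cast; rfl, fun x hx => ?_⟩
  · rw [← hf.lt_iff_lt]; simpa using hc
  · have h1 := hk x ⟨hx.1, hx.2.trans (min_le_left _ _)⟩
    have h2 : f x ≤ c := by
      simpa using hf.monotone (hx.2.trans (min_le_right _ _))
    rw [Homeomorph.trans_apply, Homeomorph.trans_apply, hl _ ⟨hf.monotone hx.1, h2⟩, h1,
      zpow_add₀ two_ne_zero]
    ring

theorem exists_wordPoint_eq_of_mem {w : List Bool} {x : I}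
    (hx : x ∈ Set.Icc (wordPoint w 0) (wordPoint w 1)) : ∃ s, x = wordPoint w s := by
  have h0 : (wordPoint w 0 : ℝ) ≤ x := hx.1
  have h1 : (x : ℝ) ≤ wordPoint w 1 := hx.2
  have hpos : (0 : ℝ) < (2 : ℝ) ^ (-(w.length : ℤ)) := by positivity
  rw [wordPoint_eq w 1, Set.Icc.coe_one, mul_one] at h1
  obtain ⟨s, hs⟩ : ∃ s : I, (s : ℝ) = ((x : ℝ) - wordPoint w 0) / (2 : ℝ) ^ (-(w.length : ℤ)) :=
    ⟨⟨_, div_nonneg (by linarith) hpos.le, by rw [div_le_one hpos]; linarith⟩, rfl⟩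
  refine ⟨s, Subtype.ext ?_⟩
  rw [wordPoint_eq w s, hs, mul_div_cancel₀ _ hpos.ne']
  ring

theorem wordPoint_strictMono (w : List Bool) : StrictMono (wordPoint w) := by
  intro s t hst
  have hst' : (s : ℝ) < t := hst
  change (wordPoint w s : ℝ) < wordPoint w t
  rw [wordPoint_eq w s, wordPoint_eq w t]
  gcongr

/-- The slope exponent is the difference of the two depths, which modulo `2` is their sum. -/
theorem hasSlopeParity_wordPoint {f : I ≃ₜ I} {α β : List Bool}
    (h : ∀ s, f (wordPoint α s) = wordPoint β s) {s : I} (hs : s < 1) :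
    HasSlopeParity f (wordPoint α s) (α.length + β.length) := by
  refine ⟨wordPoint α 1, wordPoint_strictMono α hs, α.length - β.length, ?_, fun x hx => ?_⟩
  · push_cast
    rw [sub_eq_add_neg, CharTwo.neg_eq]
  · obtain ⟨r, rfl⟩ := exists_wordPoint_eq_of_mem
      ⟨((wordPoint_strictMono α).monotone unitInterval.nonneg').trans hx.1, hx.2⟩
    rw [h, h, wordPoint_eq β r, wordPoint_eq β s, wordPoint_eq α r, wordPoint_eq α s,
      sub_eq_add_neg (α.length : ℤ), zpow_add₀ two_ne_zero, zpow_neg (2 : ℝ) (α.length : ℤ)]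
    field_simp
    ring

theorem wordSign_eq_iff (v w : List Bool) :
    wordSign v = wordSign w ↔ (v.length : ZMod 2) + w.length = 0 := by
  rw [← Nat.cast_add, ZMod.natCast_eq_zero_iff_even, Nat.even_add, wordSign, wordSign]
  rcases Nat.even_or_odd v.length with hv | hv <;> rcases Nat.even_or_odd w.length with hw | hw <;>
    simp only [hv.neg_one_pow, hw.neg_one_pow] <;>
    simp [hv, hw, Nat.not_even_iff_odd.mpr] <;> decide

theorem wordSign_eq_neg_iff (v w : List Bool) :
    wordSign v = - wordSign w ↔ (v.length : ZMod 2) + w.length = 1 := by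
  rw [← wordSign_cons true w, wordSign_eq_iff, List.length_cons]
  push_cast
  rw [← add_assoc, CharTwo.add_eq_zero]

theorem TreeDiagram.exists_hasSlopeParity_of_mem_zip {D : TreeDiagram} {f : I ≃ₜ I}
    (hD : D.Represents f) {t : I} (ht : t < 1) :
    ∃ α β, (α, β) ∈ D.top.leaves.zip D.bottom.leaves ∧
      HasSlopeParity f t (α.length + β.length) := by
  obtain ⟨α, hα, s, hs, rfl⟩ := D.top.exists_leaf_wordPoint_eq t ht
  obtain ⟨i, hi, rfl⟩ := List.getElem_of_mem hα
  have hi' : i < D.bottom.leaves.length := hD.length_eq ▸ hi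
  have hz : i < (D.top.leaves.zip D.bottom.leaves).length := by simp [hi, hi']
  refine ⟨_, D.bottom.leaves[i], ?_,
    hasSlopeParity_wordPoint (List.forall₂_zip hD ?_) hs⟩ <;>
  · rw [← List.getElem_zip (h := hz)]
    exact List.getElem_mem hz

theorem IsThompson.exists_hasSlopeParity {f : I ≃ₜ I} (hf : IsThompson f) {t : I} (ht : t < 1) :
    ∃ p, HasSlopeParity f t p := by
  obtain ⟨D, hD⟩ := hf.exists_represents
  obtain ⟨α, β, -, h⟩ := TreeDiagram.exists_hasSlopeParity_of_mem_zip hD ht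
  exact ⟨_, h⟩

theorem TreeDiagram.length_add_length_eq {D : TreeDiagram} {f : I ≃ₜ I} (hD : D.Represents f)
    {p : ZMod 2} (hf : ∀ t < 1, HasSlopeParity f t p) :
    List.Forall₂ (fun α β : List Bool => (α.length : ZMod 2) + β.length = p)
      D.top.leaves D.bottom.leaves :=
  hD.imp fun α _ h => (hasSlopeParity_wordPoint h zero_lt_one).unique
    (hf _ ((wordPoint_strictMono α zero_lt_one).trans_le unitInterval.le_one'))

/-- The 3-colorable subgroup consists of the elements whose slopes are powers of `4`. -/
theorem mem_threeColorableSubgroup_iff_hasSlopeParity (f : ThompsonF) :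
    f ∈ threeColorableSubgroup ↔ ∀ t < 1, HasSlopeParity f.1 t 0 := by
  obtain ⟨D, hD⟩ := f.2.exists_represents
  rw [mem_threeColorableSubgroup_iff f D hD, D.colorable_iff]
  constructor
  · intro h t ht
    obtain ⟨α, β, hm, hp⟩ := TreeDiagram.exists_hasSlopeParity_of_mem_zip hD ht
    rw [← List.forall₂_eq_eq_eq, List.forall₂_map_left_iff, List.forall₂_map_right_iff] at h
    rwa [(wordSign_eq_iff α β).mp (List.forall₂_zip h hm)] at hp
  · intro h
    rw [← List.forall₂_eq_eq_eq, List.forall₂_map_left_iff, List.forall₂_map_right_iff]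
    exact (TreeDiagram.length_add_length_eq hD h).imp fun α β => (wordSign_eq_iff α β).mpr

/-- The slopes of an element of `F` cannot all be odd powers of `2`: modulo `3`, all of them would
be `-1`, and `[0, 1]` would be mapped onto an interval of length `-1`. -/
theorem IsThompson.not_forall_hasSlopeParity_one {f : I ≃ₜ I} (hf : IsThompson f) :
    ¬ ∀ t < 1, HasSlopeParity f t 1 := by
  intro h
  obtain ⟨D, hD⟩ := hf.exists_represents
  have h1 : D.top.leaves.map wordSign = D.bottom.leaves.map fun w => - wordSign w := by
    rw [← List.forall₂_eq_eq_eq, List.forall₂_map_left_iff, List.forall₂_map_right_iff]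
    exact (TreeDiagram.length_add_length_eq hD h).imp fun α β => (wordSign_eq_neg_iff α β).mpr
  have h2 := congrArg List.sum h1
  rw [D.top.sum_wordSign, show (fun w => - wordSign w) = Neg.neg ∘ wordSign from rfl,
    ← List.map_map, ← List.sum_neg, D.bottom.sum_wordSign] at h2
  exact absurd h2 (by decide)

/-- If the parity of the slopes of `f` is invariant under a map `φ` that moves all points of
`(0, 1)` to the right, then it is constant. -/
theorem IsThompson.exists_forall_hasSlopeParity {f φ : I ≃ₜ I} (hf : IsThompson f)
    (hφ : StrictMono φ) (hlt : ∀ t, 0 < t → t < 1 → t < φ t)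
    (hinv : ∀ t < 1, ∀ p, HasSlopeParity f (φ t) p → HasSlopeParity f t p) :
    ∃ p, ∀ t < 1, HasSlopeParity f t p := by
  obtain ⟨p, hp⟩ := hf.exists_hasSlopeParity (t := 0) zero_lt_one
  refine ⟨p, ?_⟩
  obtain ⟨b, hb, k, hk, hkb⟩ := hp
  have hnear : ∀ t < b, HasSlopeParity f t p := fun t ht => ⟨b, ht, k, hk, fun x hx => by
    rw [hkb x ⟨unitInterval.nonneg', hx.2⟩, hkb t ⟨unitInterval.nonneg', ht.le⟩]
    ring⟩
  by_contra! hcon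
  -- Since `φ` moves `sInf A` to the right, some point of `A` lies below `φ (sInf A)`. Its preimage
  -- under `φ` is again in `A` by invariance, yet lies below `sInf A`. Whether the infimum is
  -- attained plays no role.
  set A : Set I := {t | t < 1 ∧ ¬ HasSlopeParity f t p} with hA
  have hne : A.Nonempty := hcon
  have hbc : b ≤ sInf A := le_csInf hne fun t ht => not_lt.mp fun h => ht.2 (hnear t h)
  have hc0 : 0 < sInf A := hb.trans_le hbc
  have hc1 : sInf A < 1 := by
    obtain ⟨t, ht⟩ := hne
    exact (csInf_le (OrderBot.bddBelow _) ht).trans_lt ht.1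
  obtain ⟨t, ht, htc⟩ := exists_lt_of_csInf_lt hne (hlt _ hc0 hc1)
  have h1 : φ.symm t < sInf A := by
    rw [← hφ.lt_iff_lt]; simpa using htc
  have h2 : φ.symm t < 1 := h1.trans hc1
  obtain ⟨q, hq⟩ := hf.exists_hasSlopeParity ht.1
  have h3 := hinv _ h2 q (by simpa using hq)
  have h4 : φ.symm t ∈ A := ⟨h2, fun h4 => ht.2 (h4.unique h3 ▸ hq)⟩
  exact absurd (csInf_le (OrderBot.bddBelow _) h4) (not_le.mpr h1)

/-- Fixing the coset means `φ * g = g * h` with `h` in the subgroup. As `φ` and `h` have even slope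
exponents, the chain rule for both sides equates the parities of `g` at `φ t` and at `t`. -/
theorem ThompsonF.mem_of_smul_coset_eq {g φ : ThompsonF} (hφ : φ ∈ threeColorableSubgroup)
    (hlt : ∀ t, 0 < t → t < 1 → t < φ.1 t)
    (heq : φ • (g : ThompsonF ⧸ threeColorableSubgroup) = g) : g ∈ threeColorableSubgroup := by
  rw [MulAction.Quotient.smul_coe, smul_eq_mul, eq_comm, QuotientGroup.eq,
    mem_threeColorableSubgroup_iff_hasSlopeParity] at heq
  rw [mem_threeColorableSubgroup_iff_hasSlopeParity] at hφ ⊢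
  have hmap : ∀ (f : ThompsonF) (t : I), t < 1 → f.1 t < 1 := fun f t ht =>
    (f.2.strictMono ht).trans_le unitInterval.le_one'
  obtain ⟨p, hp⟩ := g.2.exists_forall_hasSlopeParity φ.2.strictMono hlt fun t ht p hp => by
    have h1 : HasSlopeParity (φ * g).1 t (0 + p) :=
      HasSlopeParity.trans φ.2.strictMono (hφ t ht) hp
    obtain ⟨q, hq⟩ := g.2.exists_hasSlopeParity ht
    have h2 : HasSlopeParity (g * (g⁻¹ * (φ * g))).1 t (q + 0) :=
      HasSlopeParity.trans g.2.strictMono hq (heq _ (hmap g t ht))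
    rw [mul_inv_cancel_left] at h2
    rwa [← zero_add p, h1.unique h2, add_zero]
  have hp2 : p = 0 ∨ p = 1 := (by decide : ∀ q : ZMod 2, q = 0 ∨ q = 1) p
  rcases hp2 with rfl | rfl
  · exact hp
  · exact absurd hp g.2.not_forall_hasSlopeParity_one

/-! ### A 3-colorable element without fixed points in `(0, 1)` -/

/-- The homeomorphism with slopes `4`, `1`, `1 / 4` and breakpoints `1 / 8`, `1 / 2`. -/
noncomputable def pushRightHomeomorph : I ≃ₜ I where
  -- The slopes decrease, so the map is concave and equals the minimum of its affine pieces. Its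
  -- inverse is the maximum of the inverse pieces.
  toFun x := ⟨min (4 * (x : ℝ)) (min (x + 3 / 8) (x / 4 + 3 / 4)), by
    have h0 := x.2.1
    have h1 := x.2.2
    exact ⟨by simp only [le_min_iff]; constructor <;> [skip; constructor] <;> linarith,
      by simp only [min_le_iff]; right; right; linarith⟩⟩
  invFun x := ⟨max ((x : ℝ) / 4) (max (x - 3 / 8) (4 * x - 3)), by
    have h0 := x.2.1
    have h1 := x.2.2
    exact ⟨by simp only [le_max_iff]; left; linarith,
      by simp only [max_le_iff]; constructor <;> [skip; constructor] <;> linarith⟩⟩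
  left_inv x := by
    apply Subtype.ext
    simp only [min_def, max_def]
    split_ifs <;> linarith
  right_inv x := by
    apply Subtype.ext
    simp only [min_def, max_def]
    split_ifs <;> linarith
  continuous_toFun := by fun_prop
  continuous_invFun := by fun_prop

theorem pushRightHomeomorph_apply (x : I) : (pushRightHomeomorph x : ℝ) =
    min (4 * (x : ℝ)) (min (x + 3 / 8) (x / 4 + 3 / 4)) := rfl

theorem pushRightHomeomorph_of_le {x : I} (h : (x : ℝ) ≤ 1 / 8) :
    (pushRightHomeomorph x : ℝ) = 4 * x := by
  rw [pushRightHomeomorph_apply, min_eq_left (le_min (by linarith) (by linarith))]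

theorem pushRightHomeomorph_of_mem {x : I} (h : 1 / 8 ≤ (x : ℝ)) (h' : (x : ℝ) ≤ 1 / 2) :
    (pushRightHomeomorph x : ℝ) = x + 3 / 8 := by
  rw [pushRightHomeomorph_apply, min_eq_left (a := (x : ℝ) + 3 / 8) (by linarith),
    min_eq_right (by linarith)]

theorem pushRightHomeomorph_of_ge {x : I} (h : 1 / 2 ≤ (x : ℝ)) :
    (pushRightHomeomorph x : ℝ) = x / 4 + 3 / 4 := by
  rw [pushRightHomeomorph_apply, min_eq_right (a := (x : ℝ) + 3 / 8) (by linarith),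
    min_eq_right (by linarith)]

theorem lt_pushRightHomeomorph {x : I} (h0 : 0 < x) (h1 : x < 1) : x < pushRightHomeomorph x := by
  have h0' : (0 : ℝ) < x := h0
  have h1' : (x : ℝ) < 1 := h1
  change (x : ℝ) < _
  rw [pushRightHomeomorph_apply, lt_min_iff, lt_min_iff]
  exact ⟨by linarith, by linarith, by linarith⟩

theorem isThompson_pushRightHomeomorph : IsThompson pushRightHomeomorph := by
  refine ⟨{⟨1 / 8, by norm_num, by norm_num⟩, ⟨1 / 2, by norm_num, by norm_num⟩}, ?_, ?_⟩
  · intro s hs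
    rcases Finset.mem_insert.mp hs with rfl | hs
    · exact ⟨1, 3, by norm_num⟩
    · rw [Finset.mem_singleton.mp hs]
      exact ⟨1, 1, by norm_num⟩
  · intro a b hab hS
    have hab' : (a : ℝ) < b := hab
    have h1 : ¬ ((a : ℝ) < 1 / 8 ∧ 1 / 8 < (b : ℝ)) := hS _ (Finset.mem_insert_self _ _)
    have h2 : ¬ ((a : ℝ) < 1 / 2 ∧ 1 / 2 < (b : ℝ)) :=
      hS _ (Finset.mem_insert_of_mem (Finset.mem_singleton_self _))
    rw [not_and_or, not_lt, not_lt] at h1 h2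
    rcases h1 with h1 | h1
    · rcases h2 with h2 | h2
      · refine ⟨-2, fun t ht => ?_⟩
        have hat : (a : ℝ) ≤ t := ht.1
        rw [pushRightHomeomorph_of_ge h2, pushRightHomeomorph_of_ge (h2.trans hat)]
        norm_num
        ring
      · refine ⟨0, fun t ht => ?_⟩
        have hat : (a : ℝ) ≤ t := ht.1
        have htb : (t : ℝ) ≤ b := ht.2
        rw [pushRightHomeomorph_of_mem h1 (by linarith),
          pushRightHomeomorph_of_mem (h1.trans hat) (by linarith)]
        norm_num
        ring
    · refine ⟨2, fun t ht => ?_⟩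
      have htb : (t : ℝ) ≤ b := ht.2
      rw [pushRightHomeomorph_of_le (by linarith), pushRightHomeomorph_of_le (by linarith)]
      norm_num
      ring

noncomputable def ThompsonF.pushRight : ThompsonF := ⟨pushRightHomeomorph, isThompson_pushRightHomeomorph⟩

theorem ThompsonF.pushRight_mem : pushRight ∈ threeColorableSubgroup := by
  rw [mem_threeColorableSubgroup_iff_hasSlopeParity]
  intro t ht
  -- Slopes are taken to the right, so each breakpoint belongs to the piece that starts there.
  by_cases h1 : (t : ℝ) < 1 / 8
  · refine ⟨⟨1 / 8, by norm_num, by norm_num⟩, h1, 2, by decide, fun x hx => ?_⟩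
    have hx2 : (x : ℝ) ≤ 1 / 8 := hx.2
    change (pushRightHomeomorph x : ℝ) = pushRightHomeomorph t + _
    rw [pushRightHomeomorph_of_le hx2, pushRightHomeomorph_of_le h1.le]
    norm_num
    ring
  by_cases h2 : (t : ℝ) < 1 / 2
  · refine ⟨⟨1 / 2, by norm_num, by norm_num⟩, h2, 0, by decide, fun x hx => ?_⟩
    have hx1 : (t : ℝ) ≤ x := hx.1
    have hx2 : (x : ℝ) ≤ 1 / 2 := hx.2
    change (pushRightHomeomorph x : ℝ) = pushRightHomeomorph t + _
    rw [pushRightHomeomorph_of_mem (by linarith) hx2,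
      pushRightHomeomorph_of_mem (by linarith) h2.le]
    norm_num
    ring
  · refine ⟨1, ht, -2, by decide, fun x hx => ?_⟩
    have hx1 : (t : ℝ) ≤ x := hx.1
    change (pushRightHomeomorph x : ℝ) = pushRightHomeomorph t + _
    rw [pushRightHomeomorph_of_ge (by linarith), pushRightHomeomorph_of_ge (by linarith)]
    norm_num
    ring

theorem ThompsonF.lt_pow_apply {φ : ThompsonF} (hφ : ∀ t, 0 < t → t < 1 → t < φ.1 t) {n : ℕ}
    (hn : 0 < n) (t : I) (h0 : 0 < t) (h1 : t < 1) : t < (φ ^ n).1 t := by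
  induction n, hn using Nat.le_induction with
  | base => simpa using hφ t h0 h1
  | succ n _ ih =>
    rw [pow_succ, ThompsonF.mul_apply]
    refine ih.trans (hφ _ (h0.trans ih) ?_)
    exact ((φ ^ n).2.strictMono h1).trans_le unitInterval.le_one'

theorem mainTheorem6 : IsIrreducibleUnitary (quasiRegular threeColorableSubgroup) := by
  refine isIrreducibleUnitary_quasiRegular_of_forall_pow _ fun g hg =>
    ⟨ThompsonF.pushRight, ThompsonF.pushRight_mem, fun n hn heq => hg ?_⟩
  -- Applied to the power itself, which still lies in the subgroup and still pushes `(0, 1)` to the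
  -- right.
  exact ThompsonF.mem_of_smul_coset_eq (Subgroup.pow_mem _ ThompsonF.pushRight_mem n)
    (ThompsonF.lt_pow_apply (fun _ h0 h1 => lt_pushRightHomeomorph h0 h1) hn) heq
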